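/- Let $F$ be a number field with ring of integers $\mathcal{O}$, regarded as a discrete topological ring. Let $\mathsf{LCA}_{\mathcal{O}}$ be the category of locally compact $\mathcal{O}$-modules: an object is an $\mathcal{O}$-module $G$ whose additive group carries a locally compact Hausdorff group topology such that every element of $\mathcal{O}$ acts on $G$ by a continuous endomorphism, and the morphisms are the continuous $\mathcal{O}$-linear maps. A sequence $G' \xrightarrow{f} G \xrightarrow{g} G''$ in $\mathsf{LCA}_{\mathcal{O}}$ is called exact if $f$ is an injective closed map, $g$ is a surjective open map, and $f(G')=\ker g$. An object is called a vector $\mathcal{O}$-module if its underlying topological additive group is isomorphic to $\mathbb{R}^n$ for some $n\ge 0$. Let $\mathsf{LCA}_{\mathcal{O},\mathbb{R}D}$ be the full subcategory of $\mathsf{LCA}_{\mathcal{O}}$ of those objects which are isomorphic in $\mathsf{LCA}_{\mathcal{O}}$ to $V\oplus D$ for some vector $\mathcal{O}$-module $V$ and some discrete $\mathcal{O}$-module $D$. Then $\mathsf{LCA}_{\mathcal{O},\mathbb{R}D}$ is closed under extensions in $\mathsf{LCA}_{\mathcal{O}}$: for every exact sequence $G' \to G \to G''$ in $\mathsf{LCA}_{\mathcal{O}}$,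 if $G'$ and $G''$ lie in $\mathsf{LCA}_{\mathcal{O},\mathbb{R}D}$, then so does $G$. -/

import Mathlib

open CategoryTheory

universe u v

/-- A topological `R`-module is locally compact if its additive group is an LCA group,
i.e. is locally compact and Hausdorff. -/
def isLocallyCompactModule (R : Type u) [CommRing R] [TopologicalSpace R] :
    ObjectProperty (TopModuleCat.{v} R) :=
  fun M => LocallyCompactSpace M ∧ T2Space M

/-- The category `LCA_R` of locally compact (Hausdorff) `R`-modules, with the continuous `R`-linear
maps as morphisms. It is used for a discrete ring `R` only; joint continuity of `R × M → M`
then says that each element of `R` acts by a continuous endomorphism of `M`. -/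
abbrev LCAMod (R : Type u) [CommRing R] [TopologicalSpace R] : Type (max u (v + 1)) :=
  (isLocallyCompactModule.{u, v} R).FullSubcategory

namespace LCAMod

variable {R : Type u} [CommRing R] [TopologicalSpace R]

/-- The continuous `R`-linear map underlying a morphism of `LCA_R`. -/
abbrev toCLM {G H : LCAMod.{u, v} R} (f : G ⟶ H) : G.obj →L[R] H.obj :=
  TopModuleCat.Hom.hom f.hom

/-- The direct sum `V ⊕ D` in `LCA_R`: the product module with the product topology. -/
noncomputable def directSum (V D : LCAMod.{u, v} R) : LCAMod.{u, v} R where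
  obj := TopModuleCat.of R (V.obj × D.obj)
  property := by
    obtain ⟨_, _⟩ := V.property
    obtain ⟨_, _⟩ := D.property
    exact ⟨inferInstanceAs (LocallyCompactSpace (V.obj × D.obj)),
      inferInstanceAs (T2Space (V.obj × D.obj))⟩

/-- Vector `R`-modules: the additive topological group is isomorphic to `ℝⁿ` for some `n ≥ 0`. -/
def isVectorModule (R : Type u) [CommRing R] [TopologicalSpace R] :
    ObjectProperty (LCAMod.{u, v} R) :=
  fun G => ∃ n : ℕ, Nonempty (G.obj ≃ₜ+ (Fin n → ℝ))

/-- Discrete `R`-modules. -/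
def isDiscreteModule (R : Type u) [CommRing R] [TopologicalSpace R] :
    ObjectProperty (LCAMod.{u, v} R) :=
  fun G => DiscreteTopology G.obj

/-- The objects of `LCA_{R,ℝD}`: those isomorphic in `LCA_R` to `V ⊕ D` for some vector
`R`-module `V` and some discrete `R`-module `D`. -/
def isVectorSumDiscrete (R : Type u) [CommRing R] [TopologicalSpace R] :
    ObjectProperty (LCAMod.{u, v} R) :=
  fun G => ∃ V D : LCAMod.{u, v} R,
    isVectorModule R V ∧ isDiscreteModule R D ∧ Nonempty (G ≅ directSum V D)

/-- Admissible monics of `LCA_R`: the closed injective (continuous) `R`-module homomorphisms. -/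
def IsAdmissibleMonic {G H : LCAMod.{u, v} R} (f : G ⟶ H) : Prop :=
  Function.Injective (toCLM f) ∧ IsClosedMap (toCLM f)

/-- Admissible epics of `LCA_R`: the open surjective (continuous) `R`-module homomorphisms. -/
def IsAdmissibleEpic {G H : LCAMod.{u, v} R} (f : G ⟶ H) : Prop :=
  Function.Surjective (toCLM f) ∧ IsOpenMap (toCLM f)

/-- The exact sequences `G' ↪ G ↠ G''` of the (quasi-abelian) exact structure of `LCA_R`.
Mathlib's `ShortComplex.ShortExact` is not suitable here: it only asks for a mono and an epi, not
for a kernel-cokernel pair, so that `ℝ_δ → ℝ → 0` with `ℝ_δ` discrete would count as exact. -/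
def IsExactSequence (S : ShortComplex (LCAMod.{u, v} R)) : Prop :=
  IsAdmissibleMonic S.f ∧ Function.Exact (toCLM S.f) (toCLM S.g) ∧ IsAdmissibleEpic S.g

/-- The full subcategory of `LCA_R` on the objects satisfying `P` is closed under extensions:
the middle term of an exact sequence lies in it whenever both outer terms do. -/
def IsExtensionClosed (P : ObjectProperty (LCAMod.{u, v} R)) : Prop :=
  ∀ S : ShortComplex (LCAMod.{u, v} R), IsExactSequence S → P S.X₁ → P S.X₃ → P S.X₂

end LCAMod

/-!
An `𝓞`-module `G` in `LCA_𝓞` is the sum of a vector module and a discrete module if and only if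
its underlying topological group has an open subgroup isomorphic to some `ℝⁿ`. Indeed such a
subgroup `P` is connected and clopen, so it is stable under `𝓞`; it is uniquely divisible, and every
nonzero element of `𝓞` divides a nonzero integer, so `P` satisfies Baer's criterion. Hence the
identity of `P` extends to an `𝓞`-linear retraction `ρ : G → P`, which is automatically continuous
because `P` is open, and `G ≅ P ⊕ ker ρ` with `ker ρ` discrete
(`LCAMod.isVectorSumDiscrete_of_isOpenEmbedding`).

It remains to see that having an open subgroup `ℝⁿ` passes to extensions `G' → G → G''` of
topological abelian groups (`exists_isOpenEmbedding_of_exact`). Let `ℝᵐ ⊆ G'` and `ℝⁿ ⊆ G''` be open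
subgroups. If the inclusion of `ℝⁿ` lifts to a continuous homomorphism `σ : ℝⁿ → G`, then
`(v, w) ↦ v + σ w` identifies `ℝᵐ × ℝⁿ` with an open subgroup of `G`. It is enough to lift
one-parameter groups `γ : ℝ → G''` (`exists_continuous_lift`). For `t` in a short interval, lift
`γ t` arbitrarily to elements of a small neighbourhood `U` of `0` in `G`, and continue by multiples
of one fixed lift. The resulting map `S : ℝ → G` fails to be additive only by sums of four elements
of `U ∪ -U` lying in the kernel, that is, by elements of the unit ball of `ℝᵐ` if `U` is small. This
defect is a bounded symmetric cocycle with values in a Banach space, hence the coboundary of a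
bounded cochain `d` (`exists_bounded_coboundary`, the argument of Hyers and Ulam), and `σ = S - d`
is a homomorphism. It is continuous since for small `t` the multiples `k • σ t` stay within bounded
distance of `U`.
-/

open Filter Topology

/-! ### Lifting one-parameter groups -/

/-- A bounded symmetric `2`-cocycle with values in a Banach space is the coboundary of a bounded
cochain. The hypothesis `hc` is what the cocycle identity and symmetry give for the pair of
doublings `a + a`, `b + b`; it makes the series for the coboundary telescope. -/
theorem exists_bounded_coboundary {A E : Type*} [AddCommGroup A] [NormedAddCommGroup E]
    [NormedSpace ℝ E] [CompleteSpace E] (c : A → A → E) (hb : ∀ a b, ‖c a b‖ ≤ 1)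
    (hc : ∀ a b, c a a + c b b - c (a + b) (a + b) = (2 : ℝ) • c a b - c (a + a) (b + b)) :
    ∃ d : A → E, (∀ a, ‖d a‖ ≤ 1) ∧ ∀ a b, d a + d b - d (a + b) = c a b := by
  have hgeo : ∀ x y : ℕ → A, ∀ k, ‖((1 / 2 : ℝ) ^ k) • c (x k) (y k)‖ ≤ (1 / 2 : ℝ) ^ k := by
    intro x y k
    rw [norm_smul, Real.norm_of_nonneg (by positivity)]
    exact mul_le_of_le_one_right (by positivity) (hb _ _)
  have hs : ∀ x y : ℕ → A, Summable fun k => ((1 / 2 : ℝ) ^ k) • c (x k) (y k) := fun x y =>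
    Summable.of_norm_bounded summable_geometric_two (hgeo x y)
  let f : A → ℕ → E := fun a k => ((1 / 2 : ℝ) ^ k) • c (2 ^ k • a) (2 ^ k • a)
  have hf : ∀ a, Summable (f a) := fun a => hs (fun k => 2 ^ k • a) (fun k => 2 ^ k • a)
  refine ⟨fun a => (1 / 2 : ℝ) • ∑' k, f a k, fun a => ?_, fun a b => ?_⟩
  · have h2 : ‖∑' k, f a k‖ ≤ 2 :=
      tsum_of_norm_bounded hasSum_geometric_two (hgeo (fun k => 2 ^ k • a) (fun k => 2 ^ k • a))
    rw [norm_smul, Real.norm_of_nonneg (by positivity)]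
    linarith
  · let p : ℕ → E := fun k => ((1 / 2 : ℝ) ^ k) • c (2 ^ k • a) (2 ^ k • b)
    have hp : Summable p := hs (fun k => 2 ^ k • a) (fun k => 2 ^ k • b)
    have hterm : ∀ k, f a k + f b k - f (a + b) k = (2 : ℝ) • (p k - p (k + 1)) := by
      intro k
      have h := hc (2 ^ k • a) (2 ^ k • b)
      simp only [f, p, smul_add] at h ⊢
      rw [← smul_add, ← smul_sub, h, pow_succ, pow_succ, mul_smul _ 2 a, mul_smul _ 2 b,
        two_nsmul a, two_nsmul b, smul_add, smul_add]
      module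
    have hp' : Summable fun k => p (k + 1) := (summable_nat_add_iff 1).2 hp
    have h1 : ∑' k, f a k + ∑' k, f b k - ∑' k, f (a + b) k = (2 : ℝ) • p 0 := by
      rw [← (hf a).tsum_add (hf b), ← ((hf a).add (hf b)).tsum_sub (hf (a + b)), tsum_congr hterm,
        (hp.sub hp').tsum_const_smul, hp.tsum_sub hp', hp.tsum_eq_zero_add, add_sub_cancel_right]
    rw [← smul_add, ← smul_sub, h1]
    simp [p]

/-- A homomorphism `γ` mapping `[0, 1]` into `g '' U` lifts to a map `S : ℝ → G` whose defect from
additivity is made of four elements of `U`: lift `γ t` for `t ∈ [0, 1]` into `U` in any way, and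
extend by integer multiples of the lift of `γ 1`. -/
theorem exists_quasiadditive_lift {G Q : Type*} [AddCommGroup G] [AddCommGroup Q] (g : G →+ Q)
    (γ : ℝ →+ Q) (U : Set G) (hU0 : (0 : G) ∈ U)
    (hU : ∀ t ∈ Set.Icc (0 : ℝ) 1, γ t ∈ g '' U) :
    ∃ S : ℝ → G, (∀ t, g (S t) = γ t) ∧ (∀ t ∈ Set.Ico (0 : ℝ) 1, S t ∈ U) ∧
      ∀ a b, ∃ u₁ ∈ U, ∃ u₂ ∈ U, ∃ u₃ ∈ U, ∃ u₄ ∈ U,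
        S a + S b - S (a + b) = u₁ + u₂ - u₃ - u₄ := by
  choose! s hsU hs using hU
  have hfr : ∀ t : ℝ, Int.fract t ∈ Set.Icc (0 : ℝ) 1 := fun t =>
    ⟨Int.fract_nonneg t, (Int.fract_lt_one t).le⟩
  have h1 : (1 : ℝ) ∈ Set.Icc (0 : ℝ) 1 := ⟨zero_le_one, le_rfl⟩
  refine ⟨fun t => ⌊t⌋ • s 1 + s (Int.fract t), fun t => ?_, fun t ht => ?_, fun a b => ?_⟩
  · rw [map_add, map_zsmul, hs 1 h1, hs _ (hfr t), ← map_zsmul, ← map_add, zsmul_one,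
      Int.floor_add_fract]
  · simpa [Int.floor_eq_zero_iff.2 ht, Int.fract_eq_self.2 ht] using hsU t ⟨ht.1, ht.2.le⟩
  · have hle := Int.le_floor_add a b
    have hge := Int.le_floor_add_floor a b
    have hcases : ⌊a + b⌋ = ⌊a⌋ + ⌊b⌋ ∨ ⌊a + b⌋ = ⌊a⌋ + ⌊b⌋ + 1 := by omega
    rcases hcases with h | h
    · refine ⟨_, hsU _ (hfr a), _, hsU _ (hfr b), _, hsU _ (hfr (a + b)), 0, hU0, ?_⟩
      simp only [h]
      module
    · refine ⟨_, hsU _ (hfr a), _, hsU _ (hfr b), _, hsU _ (hfr (a + b)), s 1, hsU 1 h1, ?_⟩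
      simp only [h]
      module

theorem exists_symmetric_nhds_add_add_sub_sub_mem {G : Type*} [AddCommGroup G]
    [TopologicalSpace G] [IsTopologicalAddGroup G] {O : Set G} (hO : O ∈ 𝓝 (0 : G)) :
    ∃ U ∈ 𝓝 (0 : G), (∀ u ∈ U, -u ∈ U) ∧
      ∀ u₁ ∈ U, ∀ u₂ ∈ U, ∀ u₃ ∈ U, ∀ u₄ ∈ U, u₁ + u₂ - u₃ - u₄ ∈ O := by
  obtain ⟨W, hWo, hW0, hW⟩ := exists_open_nhds_zero_half hO
  obtain ⟨X, hXo, hX0, hX⟩ := exists_open_nhds_zero_half (hWo.mem_nhds hW0)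
  refine ⟨X ∩ -X, inter_mem (hXo.mem_nhds hX0) (neg_mem_nhds_zero G (hXo.mem_nhds hX0)),
    fun u hu => ⟨hu.2, by simpa using hu.1⟩, fun u₁ h₁ u₂ h₂ u₃ h₃ u₄ h₄ => ?_⟩
  have := hW _ (hX _ h₁.1 _ h₂.1) _ (hX _ h₃.2 _ h₄.2)
  convert this using 1
  abel

/-- One-parameter groups lift along an open homomorphism `g : G → Q` whose kernel contains, as a
relatively open subgroup, the additive group `j E` of a Banach space. The kernel itself need not
be divisible or torsion-free. -/
theorem exists_continuous_lift {G Q E : Type*} [AddCommGroup G] [TopologicalSpace G]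
    [IsTopologicalAddGroup G] [AddCommGroup Q] [TopologicalSpace Q]
    [NormedAddCommGroup E] [NormedSpace ℝ E] [CompleteSpace E]
    (g : G →+ Q) (hg : IsOpenMap g) (j : E →+ G) (hjc : Continuous j)
    (hji : Function.Injective j) (hgj : ∀ v, g (j v) = 0)
    (hj : ∀ A ∈ 𝓝 (0 : E), j '' A ∈ 𝓝[{x | g x = 0}] 0)
    (γ : ℝ →+ Q) (hγ : Continuous γ) :
    ∃ σ : ℝ →+ G, Continuous σ ∧ ∀ t, g (σ t) = γ t := by
  obtain ⟨O, hO, hOj⟩ := mem_nhdsWithin_iff_exists_mem_nhds_inter.1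
    (hj _ (Metric.ball_mem_nhds 0 one_pos))
  replace hOj : ∀ x ∈ O, g x = 0 → ∃ v, ‖v‖ ≤ 1 ∧ j v = x := by
    intro x hx hgx
    obtain ⟨v, hv, hvx⟩ := hOj ⟨hx, hgx⟩
    exact ⟨v, (mem_ball_zero_iff.1 hv).le, hvx⟩
  obtain ⟨U, hU, hUneg, hUO⟩ := exists_symmetric_nhds_add_add_sub_sub_mem hO
  have hU0 : (0 : G) ∈ U := mem_of_mem_nhds hU
  have himg : ∀ X ∈ 𝓝 (0 : G), ∀ᶠ t in 𝓝 (0 : ℝ), γ t ∈ g '' X := by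
    intro X hX
    apply hγ.continuousAt
    rw [map_zero, ← map_zero g]
    exact hg.image_mem_nhds hX
  obtain ⟨ε, hε, hball⟩ := Metric.eventually_nhds_iff.1 (himg U hU)
  -- After rescaling, the whole unit interval is mapped into `g '' U`.
  suffices H : ∀ γ : ℝ →+ Q, Continuous γ → (∀ t ∈ Set.Icc (0 : ℝ) 1, γ t ∈ g '' U) →
      (∀ X ∈ 𝓝 (0 : G), ∀ᶠ t in 𝓝 (0 : ℝ), γ t ∈ g '' X) →
      ∃ σ : ℝ →+ G, Continuous σ ∧ ∀ t, g (σ t) = γ t by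
    have hcont : Continuous (AddMonoidHom.mulLeft (ε / 2)) := by
      simpa using! continuous_const_mul (ε / 2)
    obtain ⟨σ, hσ, hgσ⟩ := H (γ.comp (AddMonoidHom.mulLeft (ε / 2))) (hγ.comp hcont)
      (fun t ht => by
        apply hball
        rw [dist_zero_right]
        simp only [AddMonoidHom.coe_mulLeft, norm_mul, Real.norm_eq_abs]
        rw [abs_of_pos (by positivity), abs_of_nonneg ht.1]
        nlinarith [ht.2])
      (fun X hX => by
        have h0 : Tendsto (AddMonoidHom.mulLeft (ε / 2)) (𝓝 (0 : ℝ)) (𝓝 0) := by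
          simpa using hcont.tendsto 0
        exact h0.eventually (himg X hX))
    refine ⟨σ.comp (AddMonoidHom.mulLeft (ε / 2)⁻¹), hσ.comp ?_, fun t => ?_⟩
    · simpa using! continuous_const_mul (ε / 2)⁻¹
    · simp only [AddMonoidHom.comp_apply, hgσ, AddMonoidHom.coe_mulLeft]
      rw [mul_inv_cancel_left₀ (by positivity)]
  clear himg hball hγ γ
  intro γ hγ hγU himg
  obtain ⟨S, hgS, hSU, hdef⟩ := exists_quasiadditive_lift g γ U hU0 hγU
  have hc : ∀ a b, ∃ v : E, ‖v‖ ≤ 1 ∧ j v = S a + S b - S (a + b) := by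
    intro a b
    obtain ⟨u₁, h₁, u₂, h₂, u₃, h₃, u₄, h₄, h⟩ := hdef a b
    apply hOj
    · rw [h]
      exact hUO u₁ h₁ u₂ h₂ u₃ h₃ u₄ h₄
    · simp [hgS]
  choose c hcb hjc' using hc
  obtain ⟨d, hdb, hd⟩ := exists_bounded_coboundary c hcb (by
    intro a b
    apply hji
    rw [two_smul]
    simp only [map_add, map_sub, hjc', add_add_add_comm a b a b]
    abel)
  let σ : ℝ →+ G := AddMonoidHom.mk' (fun t => S t - j (d t)) (by
    intro a b
    have h := hjc' a b
    rw [← hd a b, map_sub, map_add] at h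
    have h' : S (a + b) = S a + S b - (j (d a) + j (d b) - j (d (a + b))) := by
      rw [h]; abel
    rw [h']
    abel)
  have hσ : ∀ t, σ t = S t - j (d t) := fun t => rfl
  have hgσ : ∀ t, g (σ t) = γ t := by
    intro t
    rw [hσ, map_sub, hgS, hgj, sub_zero]
  have hloc : ∀ t : ℝ, |t| < 1 → ∃ u ∈ U, ∃ v : E, ‖v‖ ≤ 1 ∧ σ t = u + j v := by
    intro t ht
    rcases le_total 0 t with h0 | h0
    · refine ⟨S t, hSU t ⟨h0, (le_abs_self t).trans_lt ht⟩, -d t, by simpa using hdb t, ?_⟩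
      rw [hσ, map_neg, sub_eq_add_neg]
    · refine ⟨-S (-t), hUneg _ (hSU _ ⟨by linarith, (neg_le_abs t).trans_lt ht⟩), d (-t),
        hdb _, ?_⟩
      rw [← neg_neg t, map_neg, hσ, neg_neg]
      abel
  refine ⟨σ, ?_, hgσ⟩
  have hUU : ∀ u ∈ U, ∀ u' ∈ U, u - u' ∈ O := fun u hu u' hu' => by
    simpa using hUO u hu 0 hU0 u' hu' 0 hU0
  refine continuous_of_continuousAt_zero σ ?_
  rw [ContinuousAt, map_zero]
  intro A hA
  obtain ⟨B, hBo, hB0, hB⟩ := exists_open_nhds_zero_half hA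
  have hjB : j ⁻¹' B ∈ 𝓝 (0 : E) :=
    hjc.continuousAt.preimage_mem_nhds (by simpa using hBo.mem_nhds hB0)
  obtain ⟨r, hr, hrB⟩ := Metric.mem_nhds_iff.1 hjB
  obtain ⟨k, hk⟩ := exists_nat_gt (2 / r)
  have hk0 : (0 : ℝ) < k := lt_trans (by positivity) hk
  have hkU : (fun x : G => k • x) ⁻¹' U ∈ 𝓝 (0 : G) :=
    (continuous_nsmul k).continuousAt.preimage_mem_nhds (by simpa using hU)
  have hsmall : ∀ᶠ t : ℝ in 𝓝 0, |t| < 1 ∧ |k * t| < 1 := by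
    have h1 : ∀ᶠ t : ℝ in 𝓝 0, |t| < 1 :=
      (continuous_abs.tendsto' 0 0 abs_zero).eventually_lt_const one_pos
    have h2 : ∀ᶠ t : ℝ in 𝓝 0, |k * t| < 1 :=
      ((continuous_abs.comp (continuous_const_mul (k : ℝ))).tendsto' 0 0
        (by simp)).eventually_lt_const one_pos
    exact h1.and h2
  rw [Filter.mem_map]
  filter_upwards [hsmall, himg _ (inter_mem (hBo.mem_nhds hB0) (inter_mem hU hkU))]
    with t ⟨ht, hkt⟩ ⟨u', ⟨hu'B, hu'U, hku'⟩, hgu'⟩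
  obtain ⟨u, hu, v, hv, hσt⟩ := hloc t ht
  obtain ⟨u₁, hu₁, v₁, hv₁, hσkt⟩ := hloc _ hkt
  have hgu : g u = γ t := by rw [← hgσ t, hσt, map_add, hgj, add_zero]
  have hγk : γ (k * t) = k • γ t := by rw [← nsmul_eq_mul, map_nsmul]
  have hgu₁ : g u₁ = k • γ t := by
    rw [← hγk, ← hgσ, hσkt, map_add, hgj, add_zero]
  obtain ⟨w₀, -, hw₀⟩ := hOj _ (hUU u hu u' hu'U) (by rw [map_sub, hgu, hgu', sub_self])
  obtain ⟨w₁, hw₁b, hw₁⟩ := hOj _ (hUU u₁ hu₁ _ hku')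
    (by rw [map_sub, hgu₁, map_nsmul, hgu', sub_self])
  -- `w = w₀ + v` measures `σ t - u'`; its `k`-fold multiple stays in a ball of radius `2`.
  have hw : σ t = u' + j (w₀ + v) := by
    rw [map_add, hw₀, hσt]
    abel
  have hkw : k • (w₀ + v) = w₁ + v₁ := by
    apply hji
    have h1 : σ (k * t) = k • σ t := by rw [← nsmul_eq_mul, map_nsmul]
    rw [hσkt, hw, smul_add] at h1
    have h2 : j w₁ = u₁ - k • u' := hw₁
    rw [map_nsmul, map_add j w₁, h2, ← add_sub_cancel_left (k • u') (k • j (w₀ + v)), ← h1]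
    abel
  have hnorm : (k : ℝ) * ‖w₀ + v‖ ≤ 2 := by
    rw [← Real.norm_natCast, ← norm_smul, Nat.cast_smul_eq_nsmul, hkw]
    exact (norm_add_le _ _).trans (by linarith)
  have hwr : ‖w₀ + v‖ < r := by
    rw [div_lt_iff₀ hr] at hk
    exact lt_of_mul_lt_mul_left (hnorm.trans_lt hk) hk0.le
  rw [Set.mem_preimage, hw]
  exact hB _ hu'B _ (hrB (mem_ball_zero_iff.2 hwr))

/-! ### Extensions of groups with an open vector subgroup -/

/-- Homomorphisms from `ℝ^ι` lift as well: lift the coordinate axes one by one and add up. -/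
theorem exists_continuous_lift_pi {G Q E : Type*} [AddCommGroup G] [TopologicalSpace G]
    [IsTopologicalAddGroup G] [AddCommGroup Q] [TopologicalSpace Q]
    [NormedAddCommGroup E] [NormedSpace ℝ E] [CompleteSpace E]
    (g : G →+ Q) (hg : IsOpenMap g) (j : E →+ G) (hjc : Continuous j)
    (hji : Function.Injective j) (hgj : ∀ v, g (j v) = 0)
    (hj : ∀ A ∈ 𝓝 (0 : E), j '' A ∈ 𝓝[{x | g x = 0}] 0)
    {ι : Type*} [Fintype ι] (i : (ι → ℝ) →+ Q) (hi : Continuous i) :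
    ∃ σ : (ι → ℝ) →+ G, Continuous σ ∧ ∀ w, g (σ w) = i w := by
  classical
  have h : ∀ k : ι, ∃ σ : ℝ →+ G, Continuous σ ∧ ∀ t, g (σ t) = i (Pi.single k t) := fun k =>
    exists_continuous_lift g hg j hjc hji hgj hj (i.comp (AddMonoidHom.single (fun _ : ι => ℝ) k))
      (hi.comp (continuous_single (A := fun _ : ι => ℝ) k))
  choose σ hσc hσ using h
  refine ⟨∑ k, (σ k).comp (Pi.evalAddMonoidHom _ k), ?_, fun w => ?_⟩
  · have : ⇑(∑ k, (σ k).comp (Pi.evalAddMonoidHom (fun _ : ι => ℝ) k)) =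
        fun w => ∑ k, σ k (w k) := by
      ext w
      simp
    rw [this]
    exact continuous_finsetSum _ fun k _ => (hσc k).comp (continuous_apply k)
  · simp only [AddMonoidHom.finsetSum_apply, AddMonoidHom.comp_apply,
      Pi.evalAddMonoidHom_apply, map_sum, hσ]
    rw [← map_sum, Finset.univ_sum_single]

/-- If the outer terms of a topologically exact sequence `G' → G → Q` have open vector subgroups
`E` and `ℝ^ι`, then a lift of `ℝ^ι` to `G` together with `E` spans an open vector subgroup of the
middle term. -/
theorem exists_isOpenEmbedding_of_exact {G' G Q E : Type*}
    [AddCommGroup G'] [TopologicalSpace G']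
    [AddCommGroup G] [TopologicalSpace G] [IsTopologicalAddGroup G]
    [AddCommGroup Q] [TopologicalSpace Q] [IsTopologicalAddGroup Q]
    [NormedAddCommGroup E] [NormedSpace ℝ E] [CompleteSpace E]
    (f : G' →+ G) (hf : IsEmbedding f) (g : G →+ Q) (hgc : Continuous g) (hg : IsOpenMap g)
    (hfg : Function.Exact f g) (j : E →+ G') (hj : IsOpenEmbedding j)
    {ι : Type*} [Fintype ι] (i : (ι → ℝ) →+ Q) (hi : IsOpenEmbedding i) :
    ∃ Φ : E × (ι → ℝ) →+ G, IsOpenEmbedding Φ := by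
  have hgj : ∀ v, g (f (j v)) = 0 := fun v => hfg.apply_apply_eq_zero _
  have hker : ∀ A ∈ 𝓝 (0 : E), ∃ O ∈ 𝓝 (0 : G), ∀ x ∈ O, g x = 0 → ∃ v ∈ A, f (j v) = x := by
    intro A hA
    have h0 : j '' A ∈ 𝓝 (0 : G') := by
      rw [← map_zero j]
      exact hj.isOpenMap.image_mem_nhds hA
    rw [hf.nhds_eq_comap, map_zero, mem_comap] at h0
    obtain ⟨O, hO, hOA⟩ := h0
    refine ⟨O, hO, fun x hx hgx => ?_⟩
    obtain ⟨y, rfl⟩ := (hfg x).1 hgx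
    obtain ⟨v, hv, rfl⟩ := hOA hx
    exact ⟨v, hv, rfl⟩
  obtain ⟨σ, hσc, hσ⟩ := exists_continuous_lift_pi g hg (f.comp j)
    (hf.continuous.comp hj.continuous) (hf.injective.comp hj.injective) hgj
    (fun A hA => by
      obtain ⟨O, hO, hOA⟩ := hker A hA
      exact mem_nhdsWithin_iff_exists_mem_nhds_inter.2 ⟨O, hO, fun x hx => hOA x hx.1 hx.2⟩)
    i hi.continuous
  let Φ : E × (ι → ℝ) →+ G := (f.comp j).coprod σ
  have hΦ : ∀ p, Φ p = f (j p.1) + σ p.2 := fun p => rfl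
  have hgΦ : ∀ p, g (Φ p) = i p.2 := fun p => by rw [hΦ, map_add, hgj, zero_add, hσ]
  refine ⟨Φ, .of_continuous_injective_isOpenMap ?_ ?_ ?_⟩
  · exact ((hf.continuous.comp hj.continuous).comp continuous_fst).add
      (hσc.comp continuous_snd)
  · rw [injective_iff_map_eq_zero]
    rintro ⟨v, w⟩ h
    have hw : w = 0 := by
      apply hi.injective
      rw [← hgΦ (v, w), h, map_zero, map_zero]
    subst hw
    have hv : v = 0 := by
      apply hj.injective
      apply hf.injective
      simpa [hΦ] using h
    rw [hv, Prod.mk_zero_zero]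
  · rw [IsTopologicalAddGroup.isOpenMap_iff_nhds_zero]
    intro X hX
    rw [mem_map, ← Prod.mk_zero_zero, nhds_prod_eq, mem_prod_iff] at hX
    obtain ⟨A, hA, B, hB, hAB⟩ := hX
    obtain ⟨O, hO, hOA⟩ := hker A hA
    obtain ⟨W, hWo, hW0, hW⟩ := exists_open_nhds_zero_half hO
    have hσW : (fun w => -σ w) ⁻¹' W ∈ 𝓝 (0 : ι → ℝ) :=
      hσc.neg.continuousAt.preimage_mem_nhds (by simpa using hWo.mem_nhds hW0)
    have hiB : i '' (B ∩ (fun w => -σ w) ⁻¹' W) ∈ 𝓝 (g 0) := by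
      rw [map_zero, ← map_zero i]
      exact hi.isOpenMap.image_mem_nhds (inter_mem hB hσW)
    filter_upwards [hWo.mem_nhds hW0, hgc.continuousAt.preimage_mem_nhds hiB]
      with x hxW ⟨w, ⟨hwB, hwW⟩, hw⟩
    obtain ⟨v, hvA, hv⟩ := hOA (x + -σ w) (hW _ hxW _ hwW) (by
      rw [map_add, map_neg, hσ, hw, add_neg_cancel])
    have hx : Φ (v, w) = x := by
      rw [hΦ, hv, neg_add_cancel_right]
    rw [← hx]
    exact hAB (Set.mk_mem_prod hvA hwB)

/-! ### Open vector subgroups are direct summands -/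

theorem Module.Baer.of_smul_bijective {R M : Type*} [CommRing R] [AddCommGroup M] [Module R M]
    (h : ∀ r : R, r ≠ 0 → Function.Bijective (r • · : M → M)) : Module.Baer R M := by
  intro I φ
  by_cases hI : I = ⊥
  · subst hI
    refine ⟨0, fun x hx => ?_⟩
    have : (⟨x, hx⟩ : (⊥ : Ideal R)) = 0 := Subsingleton.elim _ _
    rw [this, map_zero, LinearMap.zero_apply]
  · obtain ⟨b, hb, hb0⟩ := Submodule.exists_mem_ne_zero_of_ne_bot hI
    obtain ⟨p, hp⟩ := (h b hb0).2 (φ ⟨b, hb⟩)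
    refine ⟨LinearMap.toSpanSingleton R M p, fun x hx => (h b hb0).1 ?_⟩
    simp only [LinearMap.toSpanSingleton_apply] at hp ⊢
    rw [smul_comm, hp, ← map_smul, ← map_smul]
    congr 1
    ext
    simp [mul_comm]

/-- Every nonzero algebraic integer divides a nonzero natural number, namely the norm of the ideal
it generates. -/
theorem NumberField.RingOfIntegers.exists_natCast_eq_mul {F : Type*} [Field F] [NumberField F]
    {r : NumberField.RingOfIntegers F} (hr : r ≠ 0) :
    ∃ n : ℕ, n ≠ 0 ∧ ∃ s, (n : NumberField.RingOfIntegers F) = s * r := by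
  refine ⟨Ideal.absNorm (Ideal.span {r}), ?_, ?_⟩
  · rw [Ne, Ideal.absNorm_eq_zero_iff, Ideal.span_singleton_eq_bot]
    exact hr
  · obtain ⟨s, hs⟩ := Ideal.mem_span_singleton'.1 (Ideal.absNorm_mem (Ideal.span {r}))
    exact ⟨s, hs.symm⟩

theorem NumberField.RingOfIntegers.baer_of_nsmul_bijective {F M : Type*} [Field F] [NumberField F]
    [AddCommGroup M] [Module (NumberField.RingOfIntegers F) M]
    (h : ∀ n : ℕ, n ≠ 0 → Function.Bijective (n • · : M → M)) :
    Module.Baer (NumberField.RingOfIntegers F) M := by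
  refine Module.Baer.of_smul_bijective fun r hr => ?_
  obtain ⟨n, hn, s, hs⟩ := exists_natCast_eq_mul hr
  have hsr : ∀ x : M, s • r • x = n • x := fun x => by
    rw [smul_smul, ← hs, Nat.cast_smul_eq_nsmul]
  refine ⟨fun x y hxy => (h n hn).1 ?_, fun y => ?_⟩
  · simp only at hxy ⊢
    rw [← hsr, hxy, hsr]
  · obtain ⟨x, hx⟩ := (h n hn).2 y
    refine ⟨s • x, ?_⟩
    simp only at hx ⊢
    rw [smul_comm, hsr, hx]

/-- The range of an open embedding of a connected group is the connected component of `0`, hence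
stable under every continuous endomorphism, in particular under scalars. -/
def openRangeSubmodule {R G E : Type*} [CommRing R] [TopologicalSpace R] [AddCommGroup G]
    [TopologicalSpace G] [IsTopologicalAddGroup G] [Module R G] [ContinuousSMul R G]
    [AddCommGroup E] [TopologicalSpace E] [PreconnectedSpace E] (j : E →+ G)
    (hj : IsOpenEmbedding j) : Submodule R G where
  __ := j.range
  smul_mem' r x hx := by
    have hclosed : IsClosed (j.range : Set G) := AddSubgroup.isClosed_of_isOpen _ (by
      rw [AddMonoidHom.coe_range]
      exact hj.isOpen_range)
    rw [AddMonoidHom.coe_range] at hclosed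
    obtain ⟨v, rfl⟩ := hx
    have hpre : IsPreconnected (Set.range fun v => r • j v) :=
      isPreconnected_range (hj.continuous.const_smul r)
    exact hpre.subset_isClopen ⟨hclosed, hj.isOpen_range⟩
      ⟨0, ⟨0, by simp⟩, ⟨0, map_zero j⟩⟩ ⟨v, rfl⟩

/-- A retraction `ρ` onto an open submodule splits the module topologically, with discrete
complement `ker ρ`. -/
def Submodule.prodKerEquivOfIsOpen {R G : Type*} [CommRing R] [AddCommGroup G]
    [TopologicalSpace G] [IsTopologicalAddGroup G] [Module R G] (P : Submodule R G)
    (ρ : G →ₗ[R] P) (hρ : ∀ x : P, ρ x = x) (hc : Continuous ρ) :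
    G ≃L[R] P × LinearMap.ker ρ where
  toFun x := (ρ x, ⟨x - ρ x, by simp [hρ]⟩)
  map_add' x y := by
    ext
    · simp
    · simp only [map_add, Submodule.coe_add, Prod.snd_add]
      abel
  map_smul' r x := by
    ext
    · simp
    · simp [smul_sub]
  invFun p := p.1 + p.2
  left_inv x := by simp
  right_inv p := by
    have h2 : ρ p.2 = 0 := p.2.2
    ext
    · simp [hρ, h2]
    · simp [hρ, h2]
  continuous_toFun := hc.prodMk
    ((continuous_id.sub (continuous_subtype_val.comp hc)).subtype_mk _)
  continuous_invFun := (continuous_subtype_val.comp continuous_fst).add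
    (continuous_subtype_val.comp continuous_snd)

namespace LCAMod

theorem exists_isOpenEmbedding_of_isVectorSumDiscrete {R : Type u} [CommRing R]
    [TopologicalSpace R] {G : LCAMod.{u, v} R} (hG : isVectorSumDiscrete R G) :
    ∃ (n : ℕ) (j : (Fin n → ℝ) →+ G.obj), IsOpenEmbedding j := by
  obtain ⟨V, D, ⟨n, ⟨φ⟩⟩, hD, ⟨e⟩⟩ := hG
  have : DiscreteTopology D.obj := hD
  let e' : G.obj ≃L[R] V.obj × D.obj :=
    ((isLocallyCompactModule R).ι.mapIso e).toContinuousLinearEquiv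
  refine ⟨n, (e'.symm.toLinearMap.toAddMonoidHom.comp (AddMonoidHom.inl V.obj D.obj)).comp
    φ.symm.toAddEquiv.toAddMonoidHom, ?_⟩
  have h1 : IsOpenEmbedding fun x : V.obj => (x, (0 : D.obj)) :=
    .of_continuous_injective_isOpenMap (by fun_prop) (fun x y h => (Prod.ext_iff.1 h).1)
      (fun A hA => by
        have : (fun x : V.obj => (x, (0 : D.obj))) '' A = A ×ˢ {0} := by
          ext ⟨x, y⟩
          simp [eq_comm]
        rw [this]
        exact hA.prod (isOpen_discrete _))
  exact (e'.symm.toHomeomorph.isOpenEmbedding.comp h1).comp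
    φ.symm.toHomeomorph.isOpenEmbedding

theorem isVectorSumDiscrete_of_isOpenEmbedding {F : Type u} [Field F] [NumberField F]
    [TopologicalSpace (NumberField.RingOfIntegers F)]
    {G : LCAMod.{u, v} (NumberField.RingOfIntegers F)} {n : ℕ}
    (j : (Fin n → ℝ) →+ G.obj) (hj : IsOpenEmbedding j) :
    isVectorSumDiscrete (NumberField.RingOfIntegers F) G := by
  obtain ⟨_, _⟩ := G.property
  let P : Submodule (NumberField.RingOfIntegers F) G.obj := openRangeSubmodule j hj
  have hPo : IsOpen (P : Set G.obj) := hj.isOpen_range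
  let e : (Fin n → ℝ) ≃ₜ+ P :=
    { hj.isEmbedding.toHomeomorph with
      map_add' := fun x y => Subtype.ext (map_add j x y) }
  have hbij : ∀ k : ℕ, k ≠ 0 → Function.Bijective (k • · : P → P) := by
    intro k hk
    have hk' : Function.Bijective (k • · : (Fin n → ℝ) → (Fin n → ℝ)) := by
      simp only [← Nat.cast_smul_eq_nsmul ℝ]
      exact (MulAction.bijective₀ (Nat.cast_ne_zero.2 hk))
    have : (k • · : P → P) = e ∘ (k • ·) ∘ e.symm := by
      funext x
      simp only [Function.comp_apply, map_nsmul, ContinuousAddEquiv.apply_symm_apply]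
    rw [this]
    exact e.bijective.comp (hk'.comp e.symm.bijective)
  obtain ⟨ρ, hρ⟩ := (NumberField.RingOfIntegers.baer_of_nsmul_bijective hbij).extension_property
    P.subtype P.injective_subtype LinearMap.id
  replace hρ : ∀ x : P, ρ x = x := fun x => LinearMap.congr_fun hρ x
  -- A homomorphism which is the identity on an open subgroup is continuous.
  have hc : Continuous ρ := by
    refine continuous_of_continuousAt_zero ρ ?_
    have h : ContinuousAt (ρ ∘ ((↑) : P → G.obj)) 0 := by
      have : ρ ∘ ((↑) : P → G.obj) = id := funext hρ
      rw [this]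
      exact continuousAt_id
    exact (hPo.isOpenEmbedding_subtypeVal.continuousAt_iff (x := 0)).1 h
  have hdisc : DiscreteTopology (LinearMap.ker ρ) := by
    refine discreteTopology_of_isOpen_singleton_zero ?_
    have : ({0} : Set (LinearMap.ker ρ)) = (↑) ⁻¹' (P : Set G.obj) := by
      ext x
      constructor
      · rintro rfl
        exact P.zero_mem
      · intro hx
        have h : ρ x = ⟨x, hx⟩ := hρ ⟨x, hx⟩
        have h0 : ρ x = 0 := x.2
        have hx0 : (⟨x, hx⟩ : P) = 0 := h.symm.trans h0
        exact Subtype.ext (congrArg Subtype.val hx0 :)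
    rw [this]
    exact hPo.preimage continuous_subtype_val
  have : LocallyCompactSpace P := hPo.locallyCompactSpace
  let V : LCAMod.{u, v} (NumberField.RingOfIntegers F) :=
    ⟨TopModuleCat.of _ P, ‹LocallyCompactSpace P›, inferInstanceAs (T2Space P)⟩
  let D : LCAMod.{u, v} (NumberField.RingOfIntegers F) :=
    ⟨TopModuleCat.of _ (LinearMap.ker ρ),
      inferInstanceAs (LocallyCompactSpace (LinearMap.ker ρ)),
      inferInstanceAs (T2Space (LinearMap.ker ρ))⟩
  refine ⟨V, D, ⟨n, ⟨e.symm⟩⟩, hdisc, ⟨(isLocallyCompactModule _).isoMk ?_⟩⟩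
  exact TopModuleCat.ofIso (Y := (directSum V D).obj) (P.prodKerEquivOfIsOpen ρ hρ hc)

end LCAMod

theorem mainTheorem9 (F : Type u) [Field F] [NumberField F]
    [TopologicalSpace (NumberField.RingOfIntegers F)]
    [DiscreteTopology (NumberField.RingOfIntegers F)] :
    LCAMod.IsExtensionClosed
      (LCAMod.isVectorSumDiscrete.{u, v} (NumberField.RingOfIntegers F)) := by
  intro S hS h₁ h₃
  obtain ⟨⟨hfi, hfc⟩, hfg, -, hgo⟩ := hS
  obtain ⟨m, j, hj⟩ := LCAMod.exists_isOpenEmbedding_of_isVectorSumDiscrete h₁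
  obtain ⟨n, i, hi⟩ := LCAMod.exists_isOpenEmbedding_of_isVectorSumDiscrete h₃
  obtain ⟨Φ, hΦ⟩ := exists_isOpenEmbedding_of_exact
    (LCAMod.toCLM S.f).toLinearMap.toAddMonoidHom
    (IsClosedEmbedding.of_continuous_injective_isClosedMap
      (LCAMod.toCLM S.f).continuous hfi hfc).isEmbedding
    (LCAMod.toCLM S.g).toLinearMap.toAddMonoidHom (LCAMod.toCLM S.g).continuous hgo hfg j hj i hi
  let e : (Fin (m + n) → ℝ) ≃L[ℝ] (Fin m → ℝ) × (Fin n → ℝ) :=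
    ContinuousLinearEquiv.ofFinrankEq (by simp)
  exact LCAMod.isVectorSumDiscrete_of_isOpenEmbedding (Φ.comp e.toLinearMap.toAddMonoidHom)
    (hΦ.comp e.toHomeomorph.isOpenEmbedding)
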